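/- Let $n\ge 1$, $\mathbb D^n=\{z\in\mathbb C^n: |z_k|<1\ \forall k\}$, $\overline{\mathbb D^n}=\{z: |z_k|\le 1\ \forall k\}$, $\mathbb T^n=\{z: |z_k|=1\ \forall k\}$, and let $\hat z_j=(z_1,\dots,z_{j-1},z_{j+1},\dots,z_n)$. Suppose that $F:\overline{\mathbb D^n}\to\mathbb C^n$ has the form $$F_j(z)=\bigl(z_j-u_j(\hat z_j)\bigr)\,G_j(z),\qquad j=1,\dots,n,$$ where $u_j:\overline{\mathbb D^{n-1}}\to\overline{\mathbb D}$ and $G_j:\overline{\mathbb D^n}\to\mathbb C$ are continuous, $u_j$ is holomorphic on $\mathbb D^{n-1}$, $G_j$ is holomorphic on $\mathbb D^n$, and $$\operatorname{Re}\bigl((1-\overline{z_j}\,u_j(\hat z_j))\,G_j(z)\bigr)<0\qquad\text{for all } z\in\overline{\mathbb D^n},\ j=1,\dots,n.$$ Then the following two properties hold. 1. (Holomorphic flow.) $F$ is holomorphic on $\mathbb D^n$ and continuous on $\mathbb D^n\cup\mathbb T^n$, and it generates a flow $(\varphi^t)_{t\ge 0}$ on $\mathbb D^n\cup\mathbb T^n$: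 for every $z\in\mathbb D^n\cup\mathbb T^n$ the curve $t\mapsto\varphi^t(z)$, $t\ge 0$, stays in $\mathbb D^n\cup\mathbb T^n$ and solves $\dot x=F(x)$, $x(0)=z$ (with the one-sided derivative at $t=0$); any solution of this initial value problem on an interval $[0,T]$ with values in $\mathbb D^n\cup\mathbb T^n$ coincides with it there; $\varphi^0=\mathrm{id}$ and $\varphi^{t+s}=\varphi^t\circ\varphi^s$ for $t,s\ge 0$; and $(t,z)\mapsto\varphi^t(z)$ is continuous on $[0,\infty)\times(\mathbb D^n\cup\mathbb T^n)$. Moreover, for every $t\ge 0$, $\varphi^t$ maps $\mathbb D^n$ into $\mathbb D^n$ and is holomorphic on $\mathbb D^n$. 2. (Forward invariance.) For every $t>0$ there is $R_t\in(0,1)$ such that $|\varphi^t_j(z)|<R_t$ for all $z\in\mathbb T^n$ and all $j=1,\dots,n$. -/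

import Mathlib

open Set

/-- The open unit polydisc in `ℂ^ι`. -/
def openPolydisc (ι : Type) : Set (ι → ℂ) := {z | ∀ k, ‖z k‖ < 1}

/-- The closed unit polydisc in `ℂ^ι`. -/
def closedPolydisc (ι : Type) : Set (ι → ℂ) := {z | ∀ k, ‖z k‖ ≤ 1}

/-- The unit torus (distinguished boundary of the polydisc) in `ℂ^ι`. -/
def unitTorus (ι : Type) : Set (ι → ℂ) := {z | ∀ k, ‖z k‖ = 1}

/-- The vector `z` with its `j`-th coordinate deleted; the remaining coordinates keep their
labels, so the result has coordinates indexed by `{i // i ≠ j}`. -/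
def deleteCoord {n : ℕ} (j : Fin n) (z : Fin n → ℂ) : {i : Fin n // i ≠ j} → ℂ := fun i => z i

/-- `φ` (considered for times `t ≥ 0` and initial states in `S`) is the continuous semiflow on `S`
generated by the vector field `F`: every `t ↦ φ t z` solves `x' = F x`, `x 0 = z` in `S`
(with a one-sided derivative at `t = 0`), and it is the only solution in `S`. -/
structure GeneratesFlowOn {n : ℕ} (F : (Fin n → ℂ) → (Fin n → ℂ)) (S : Set (Fin n → ℂ))
    (φ : ℝ → (Fin n → ℂ) → (Fin n → ℂ)) : Prop where
  mapsTo : ∀ t : ℝ, 0 ≤ t → MapsTo (φ t) S S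
  zero : ∀ z ∈ S, φ 0 z = z
  add : ∀ t s : ℝ, 0 ≤ t → 0 ≤ s → ∀ z ∈ S, φ (t + s) z = φ t (φ s z)
  continuousOn : ContinuousOn (fun p : ℝ × (Fin n → ℂ) => φ p.1 p.2) (Ici 0 ×ˢ S)
  solves : ∀ z ∈ S, ∀ t : ℝ, 0 ≤ t →
    HasDerivWithinAt (fun s => φ s z) (F (φ t z)) (Ici 0) t
  unique : ∀ z ∈ S, ∀ (T : ℝ) (γ : ℝ → (Fin n → ℂ)), MapsTo γ (Icc 0 T) S → γ 0 = z →
    (∀ t ∈ Icc 0 T, HasDerivWithinAt γ (F (γ t)) (Icc 0 T) t) →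
    EqOn γ (fun t => φ t z) (Icc 0 T)

/-- Holomorphic flow: `F` is holomorphic on the open polydisc, continuous on the polydisc together
with the torus, and generates there the flow `φ`, which for each `t ≥ 0` maps the open polydisc
into itself holomorphically. -/
structure HolomorphicFlowAssumption {n : ℕ} (F : (Fin n → ℂ) → (Fin n → ℂ))
    (φ : ℝ → (Fin n → ℂ) → (Fin n → ℂ)) : Prop where
  holomorphic : DifferentiableOn ℂ F (openPolydisc (Fin n))
  continuous : ContinuousOn F (openPolydisc (Fin n) ∪ unitTorus (Fin n))
  generates : GeneratesFlowOn F (openPolydisc (Fin n) ∪ unitTorus (Fin n)) φ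
  flow_mapsTo : ∀ t : ℝ, 0 ≤ t → MapsTo (φ t) (openPolydisc (Fin n)) (openPolydisc (Fin n))
  flow_holomorphic : ∀ t : ℝ, 0 ≤ t → DifferentiableOn ℂ (φ t) (openPolydisc (Fin n))

/-- Forward invariance: for each `t > 0` the torus is mapped into a polydisc of radius `R < 1`. -/
def ForwardInvarianceAssumption {n : ℕ} (φ : ℝ → (Fin n → ℂ) → (Fin n → ℂ)) : Prop :=
  ∀ t : ℝ, 0 < t → ∃ R ∈ Ioo (0 : ℝ) 1, ∀ z ∈ unitTorus (Fin n), ∀ j, φ t z j ∈ Metric.ball 0 R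

open Filter Topology Metric

open scoped NNReal

/-! The identity `conj z_j * F_j = (1 - conj z_j * u_j) * G_j - (1 - |z_j|^2) * G_j` and compactness
turn the sign hypothesis into `IsInwardField`: `Re (conj z_j * F_j) ≤ -2c + B (1 - |z_j|^2)` with `c
> 0`. A barrier argument for `|x_j|^2` then bounds every solution by `1 - κ t/(1+t)`
(`exists_norm_solution_le`), which is forward invariance. The difficulty is that `F` is only
continuous at the boundary, so uniqueness there is not automatic. By Cauchy's estimate and uniform
continuity, the Lipschitz constant of `F` at distance `ρ` from the boundary is at most `ε/ρ + C` for
any prescribed `ε > 0` (`exists_norm_sub_le`). Solutions are at distance about `κ t` at small times,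
so the gap `d` between two of them grows at relative rate about `1/(4t)`, while boundedness of `F`
gives `d ≤ d(0) + 2Mt`. Together these yield a Hölder bound in the initial state
(`exists_norm_solution_sub_le`), hence uniqueness and continuity up to the boundary. Interior
solutions come from Picard–Lindelöf, boundary ones as their uniform limits. The time-`t` maps are
locally uniform limits of holomorphic Euler iterates. -/

/-- A uniform limit of holomorphic maps on a ball is complex differentiable at the centre. -/
theorem TendstoUniformlyOn.differentiableAt_complex {E G : Type*}
    [NormedAddCommGroup E] [NormedSpace ℂ E] [NormedAddCommGroup G] [NormedSpace ℂ G]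
    [CompleteSpace G] {f : ℕ → E → G} {g : E → G} {c : E} {ρ : ℝ} (hρ : 0 < ρ)
    (h : TendstoUniformlyOn f g atTop (ball c ρ))
    (hf : ∀ m, DifferentiableOn ℂ (f m) (ball c ρ)) : DifferentiableAt ℂ g c := by
  have hsub : ∀ z ∈ ball c (ρ / 2), ball z (ρ / 2) ⊆ ball c ρ := fun z hz =>
    ball_subset_ball' (by rw [mem_ball] at hz; linarith)
  have hin : ∀ z ∈ ball c (ρ / 2), z ∈ ball c ρ := fun z hz =>
    ball_subset_ball (by linarith) hz
  have hdiff : ∀ m, ∀ z ∈ ball c (ρ / 2), DifferentiableAt ℂ (f m) z := fun m z hz =>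
    (hf m z (hin z hz)).differentiableAt (isOpen_ball.mem_nhds (hin z hz))
  have hC : UniformCauchySeqOn (fun m => fderiv ℂ (f m)) atTop (ball c (ρ / 2)) := by
    rw [Metric.uniformCauchySeqOn_iff]
    intro ε hε
    obtain ⟨N, hN⟩ := Metric.uniformCauchySeqOn_iff.1 h.uniformCauchySeqOn (ε * ρ / 8)
      (by positivity)
    refine ⟨N, fun m hm k hk z hz => ?_⟩
    -- Cauchy's estimate on a ball of radius `ρ / 2`: the difference varies by at most `2 * (ε * ρ /
    -- 8)`, so its derivative is at most `ε / 2`.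
    have hle : ‖fderiv ℂ (fun x => f m x - f k x) z‖ ≤ (ε * ρ / 4) / (ρ / 2) := by
      refine Complex.norm_fderiv_le_div_of_mapsTo_ball
        (((hf m).sub (hf k)).mono (hsub z hz)) (fun x hx => ?_) (by positivity)
      have h1 := hN m hm k hk x (hsub z hz hx)
      have h2 := hN m hm k hk z (hin z hz)
      rw [dist_eq_norm] at h1 h2
      rw [mem_closedBall, dist_eq_norm]
      calc ‖(f m x - f k x) - (f m z - f k z)‖ ≤ ‖f m x - f k x‖ + ‖f m z - f k z‖ :=
            norm_sub_le _ _
        _ ≤ ε * ρ / 4 := by linarith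
    rw [fderiv_fun_sub (hdiff m z hz) (hdiff k z hz)] at hle
    rw [dist_eq_norm]
    refine hle.trans_lt ?_
    rw [div_lt_iff₀ (by positivity)]
    nlinarith [mul_pos hε hρ]
  have hlim : ∀ z ∈ ball c (ρ / 2), ∃ l, Tendsto (fun m => fderiv ℂ (f m) z) atTop (𝓝 l) :=
    fun z hz => cauchySeq_tendsto_of_complete (hC.cauchySeq hz)
  choose! g' hg' using hlim
  exact (hasFDerivAt_of_tendstoUniformlyOn isOpen_ball (hC.tendstoUniformlyOn_of_tendsto hg')
    (fun m z hz => (hdiff m z hz).hasFDerivAt)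
    (fun z hz => h.tendsto_at (hin z hz)) (mem_ball_self (by positivity))).differentiableAt

/-- The radial retraction of `ℂ` onto the closed disc of radius `r`. -/
noncomputable def discRetract (r : ℝ) (w : ℂ) : ℂ := (r / max r ‖w‖) • w

theorem discRetract_of_norm_le {r : ℝ} (hr : 0 < r) {w : ℂ} (hw : ‖w‖ ≤ r) :
    discRetract r w = w := by
  simp [discRetract, max_eq_left hw, hr.ne']

theorem norm_discRetract_le {r : ℝ} (hr : 0 < r) (w : ℂ) : ‖discRetract r w‖ ≤ r := by
  have hm : 0 < max r ‖w‖ := lt_max_of_lt_left hr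
  rw [discRetract, norm_smul, Real.norm_of_nonneg (by positivity), div_mul_eq_mul_div,
    div_le_iff₀ hm]
  exact mul_le_mul_of_nonneg_left (le_max_right _ _) hr.le

/-- Change the point with the scaling factor frozen, then change the factor; each costs at most `‖w
- v‖`. The constant 2 is not sharp, but any Lipschitz constant serves. -/
theorem norm_discRetract_sub_le {r : ℝ} (hr : 0 < r) (w v : ℂ) :
    ‖discRetract r w - discRetract r v‖ ≤ 2 * ‖w - v‖ := by
  have hw : 0 < max r ‖w‖ := lt_max_of_lt_left hr
  have hv : 0 < max r ‖v‖ := lt_max_of_lt_left hr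
  have hsplit : discRetract r w - discRetract r v =
      (r / max r ‖w‖) • (w - v) + (r / max r ‖w‖ - r / max r ‖v‖) • v := by
    simp only [discRetract, smul_sub, sub_smul]; abel
  have h1 : ‖(r / max r ‖w‖) • (w - v)‖ ≤ ‖w - v‖ := by
    rw [norm_smul, Real.norm_of_nonneg (by positivity)]
    exact mul_le_of_le_one_left (norm_nonneg _) ((div_le_one hw).2 (le_max_left _ _))
  have h2 : ‖(r / max r ‖w‖ - r / max r ‖v‖) • v‖ ≤ ‖w - v‖ := by
    have hmax : |max r ‖v‖ - max r ‖w‖| ≤ ‖w - v‖ := by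
      calc |max r ‖v‖ - max r ‖w‖| ≤ |‖v‖ - ‖w‖| := by
            simpa only [max_comm r] using abs_max_sub_max_le_abs ‖v‖ ‖w‖ r
        _ ≤ ‖v - w‖ := abs_norm_sub_norm_le _ _
        _ = ‖w - v‖ := norm_sub_rev _ _
    have he : r / max r ‖w‖ - r / max r ‖v‖ =
        (r / max r ‖w‖) * ((max r ‖v‖ - max r ‖w‖) / max r ‖v‖) := by
      field_simp
    rw [norm_smul, he, Real.norm_eq_abs, abs_mul, abs_of_pos (div_pos hr hw), abs_div,
      abs_of_pos hv, mul_assoc]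
    refine (mul_le_of_le_one_left (by positivity) ((div_le_one hw).2 (le_max_left _ _))).trans ?_
    rw [div_mul_eq_mul_div, div_le_iff₀ hv]
    exact mul_le_mul hmax (le_max_right _ _) (norm_nonneg _) (norm_nonneg _)
  rw [hsplit]
  linarith [norm_add_le ((r / max r ‖w‖) • (w - v)) ((r / max r ‖w‖ - r / max r ‖v‖) • v)]

theorem HasDerivWithinAt.norm_sq_apply {n : ℕ} {γ : ℝ → Fin n → ℂ} {v : Fin n → ℂ} {s : Set ℝ}
    {t : ℝ} (h : HasDerivWithinAt γ v s t) (j : Fin n) :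
    HasDerivWithinAt (fun τ => ‖γ τ j‖ ^ 2)
      (2 * ((starRingEnd ℂ) (γ t j) * v j).re) s t := by
  have := (hasDerivWithinAt_pi.1 h j).norm_sq
  rwa [Complex.inner, mul_comm (v j)] at this

/-! ### Inward fields: a priori estimates and uniqueness -/

/-- `F` is continuous on the closed unit polydisc, holomorphic inside, and points inwards along
the boundary, with quantitative control near it. -/
structure IsInwardField {n : ℕ} (F : (Fin n → ℂ) → (Fin n → ℂ)) (c B : ℝ) : Prop where
  pos : 0 < c
  nonneg : 0 ≤ B
  continuousOn : ContinuousOn F (closedBall 0 1)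
  differentiableOn : DifferentiableOn ℂ F (ball 0 1)
  re_le : ∀ z ∈ closedBall (0 : Fin n → ℂ) 1, ∀ j,
    ((starRingEnd ℂ) (z j) * F z j).re ≤ -(2 * c) + B * (1 - ‖z j‖ ^ 2)

/-- `γ` solves `x' = F x` on `[0, T]` inside the closed unit polydisc. -/
structure IsPolydiscSolution {n : ℕ} (F : (Fin n → ℂ) → (Fin n → ℂ)) (T : ℝ)
    (γ : ℝ → (Fin n → ℂ)) : Prop where
  mapsTo : MapsTo γ (Icc 0 T) (closedBall 0 1)
  deriv : ∀ t ∈ Icc 0 T, HasDerivWithinAt γ (F (γ t)) (Icc 0 T) t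

namespace IsPolydiscSolution

variable {n : ℕ} {F : (Fin n → ℂ) → (Fin n → ℂ)} {T : ℝ} {γ : ℝ → (Fin n → ℂ)}

theorem continuousOn (h : IsPolydiscSolution F T γ) : ContinuousOn γ (Icc 0 T) :=
  fun t ht => (h.deriv t ht).continuousWithinAt

theorem deriv_Ici (h : IsPolydiscSolution F T γ) {t : ℝ} (ht : t ∈ Ico 0 T) :
    HasDerivWithinAt γ (F (γ t)) (Ici t) t :=
  (h.deriv t (Ico_subset_Icc_self ht)).mono_of_mem_nhdsWithin (Icc_mem_nhdsGE_of_mem ht)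

theorem mono (h : IsPolydiscSolution F T γ) {S : ℝ} (hS : S ≤ T) : IsPolydiscSolution F S γ :=
  ⟨h.mapsTo.mono_left (Icc_subset_Icc_right hS), fun t ht =>
    (h.deriv t (Icc_subset_Icc_right hS ht)).mono (Icc_subset_Icc_right hS)⟩

theorem congr (h : IsPolydiscSolution F T γ) {δ : ℝ → (Fin n → ℂ)} (hδ : EqOn δ γ (Icc 0 T)) :
    IsPolydiscSolution F T δ :=
  ⟨h.mapsTo.congr hδ.symm, fun t ht => by
    rw [hδ ht]; exact (h.deriv t ht).congr hδ (hδ ht)⟩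

theorem comp_add (h : IsPolydiscSolution F T γ) {s S : ℝ} (hs : 0 ≤ s) (hS : S + s ≤ T) :
    IsPolydiscSolution F S (fun t => γ (t + s)) := by
  have hm : MapsTo (fun t : ℝ => t + s) (Icc 0 S) (Icc 0 T) := fun t ht =>
    ⟨by linarith [ht.1], by linarith [ht.2]⟩
  refine ⟨h.mapsTo.comp hm, fun t ht => ?_⟩
  have := (h.deriv _ (hm ht)).scomp t ((hasDerivWithinAt_id t (Icc 0 S)).add_const s) hm
  simpa [Function.comp_def] using this

end IsPolydiscSolution

namespace IsInwardField

variable {n : ℕ} {F : (Fin n → ℂ) → (Fin n → ℂ)} {c B : ℝ}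

theorem exists_norm_le (hF : IsInwardField F c B) :
    ∃ M, 0 ≤ M ∧ ∀ z ∈ closedBall (0 : Fin n → ℂ) 1, ‖F z‖ ≤ M := by
  obtain ⟨M, hM⟩ := (isCompact_closedBall (0 : Fin n → ℂ) 1).exists_bound_of_continuousOn
    hF.continuousOn
  exact ⟨max M 0, le_max_right _ _, fun z hz => (hM z hz).trans (le_max_left _ _)⟩

/-- Solutions are pushed away from the boundary of the polydisc at a uniform rate. -/
theorem exists_norm_solution_le (hF : IsInwardField F c B) :
    ∃ κ, 0 < κ ∧ κ < 1 ∧ ∀ T γ, IsPolydiscSolution F T γ →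
      ∀ t ∈ Icc 0 T, ‖γ t‖ ≤ 1 - κ * (t / (1 + t)) := by
  obtain ⟨hc, hB⟩ := And.intro hF.pos hF.nonneg
  -- At contact with the barrier `1 - k s/(1+s)` the derivative of `‖γ s j‖ ^ 2` is at most `-4c +
  -- 2Bk`, which must lie below `-k`; this needs `k (1 + 2B) < 4c`. Returning from squares to norms
  -- halves `k`, since `(1 - x/2)^2 ≥ 1 - x`.
  set k := min 1 (2 * c / (1 + 2 * B)) with hk
  have hk0 : 0 < k := lt_min one_pos (by positivity)
  have hk1 : k ≤ 1 := min_le_left _ _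
  have hk2 : k * (1 + 2 * B) ≤ 2 * c := (le_div_iff₀ (by positivity)).1 (min_le_right _ _)
  refine ⟨k / 2, by positivity, by linarith, fun T γ hγ t ht => ?_⟩
  have hfrac : ∀ s : ℝ, 0 ≤ s → 0 ≤ s / (1 + s) ∧ s / (1 + s) ≤ 1 := fun s hs =>
    ⟨by positivity, by rw [div_le_one (by positivity)]; linarith⟩
  obtain ⟨ht0, ht1⟩ := hfrac t ht.1
  refine (pi_norm_le_iff_of_nonneg (by nlinarith)).2 fun j => ?_
  have hder : ∀ s : ℝ, 0 ≤ s →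
      HasDerivAt (fun s : ℝ => 1 - k * (s / (1 + s))) (-(k / (1 + s) ^ 2)) s := fun s hs => by
    have h1 : (1 + s) ≠ 0 := by positivity
    have := (((hasDerivAt_id s).div ((hasDerivAt_id s).const_add 1) h1).const_mul k).const_sub 1
    refine this.congr_deriv ?_
    simp only [id]; field_simp; ring
  have hsq : ‖γ t j‖ ^ 2 ≤ 1 - k * (t / (1 + t)) := by
    refine image_le_of_deriv_right_lt_deriv_boundary' (a := 0) (b := T)
      (f := fun s => ‖γ s j‖ ^ 2) (f' := fun s => 2 * ((starRingEnd ℂ) (γ s j) * F (γ s) j).re)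
      (B := fun s => 1 - k * (s / (1 + s))) (B' := fun s => -(k / (1 + s) ^ 2))
      (fun s hs => ((hγ.deriv s hs).norm_sq_apply j).continuousWithinAt)
      (fun s hs => (hγ.deriv_Ici hs).norm_sq_apply j) ?_
      (fun s hs => (hder s hs.1).continuousAt.continuousWithinAt)
      (fun s hs => (hder s hs.1).hasDerivWithinAt) ?_ ht
    · have h0 := hγ.mapsTo ⟨le_rfl, ht.1.trans ht.2⟩
      have := (norm_le_pi_norm (γ 0) j).trans (mem_closedBall_zero_iff.1 h0)
      simpa using this
    · intro s hs hEq
      have hin := hF.re_le (γ s) (hγ.mapsTo (Ico_subset_Icc_self hs)) j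
      rw [hEq] at hin
      obtain ⟨hs0, hs1⟩ := hfrac s hs.1
      have h1 : k / (1 + s) ^ 2 ≤ k :=
        div_le_self hk0.le (one_le_pow₀ (by linarith [hs.1]))
      have h2 : B * (k * (s / (1 + s))) ≤ B * k :=
        mul_le_mul_of_nonneg_left (mul_le_of_le_one_right hk0.le hs1) hB
      nlinarith
  have : ‖γ t j‖ ^ 2 ≤ (1 - k / 2 * (t / (1 + t))) ^ 2 := by nlinarith [sq_nonneg (k * (t / (1 + t)))]
  exact le_of_sq_le_sq this (by nlinarith)

/-- The Lipschitz constant of `F` at distance `ρ` from the boundary is `o(1 / ρ)`. -/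
theorem exists_norm_sub_le (hF : IsInwardField F c B) {ε : ℝ} (hε : 0 < ε) :
    ∃ C, 0 ≤ C ∧ ∀ ρ, 0 < ρ → ∀ z ∈ closedBall (0 : Fin n → ℂ) (1 - ρ),
      ∀ w ∈ closedBall (0 : Fin n → ℂ) (1 - ρ), ‖F z - F w‖ ≤ (ε / ρ + C) * ‖z - w‖ := by
  -- On balls of radius `min ρ δ` the field oscillates by at most `ε`, so Cauchy's estimate bounds
  -- its derivative by `ε / min ρ δ ≤ ε / ρ + ε / δ`.
  obtain ⟨δ, hδ, hunif⟩ := Metric.uniformContinuousOn_iff.1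
    ((isCompact_closedBall (0 : Fin n → ℂ) 1).uniformContinuousOn_of_continuous hF.continuousOn)
    ε hε
  refine ⟨ε / δ, by positivity, fun ρ hρ z hz w hw => ?_⟩
  have hsub : closedBall (0 : Fin n → ℂ) (1 - ρ) ⊆ ball 0 1 :=
    closedBall_subset_ball (by linarith)
  refine (convex_closedBall (0 : Fin n → ℂ) (1 - ρ)).norm_image_sub_le_of_norm_fderiv_le (𝕜 := ℂ)
    (fun x hx => (hF.differentiableOn x (hsub hx)).differentiableAt
      (isOpen_ball.mem_nhds (hsub hx))) (fun x hx => ?_) hw hz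
  have hm : 0 < min ρ δ := lt_min hρ hδ
  have hball : ball x (min ρ δ) ⊆ ball 0 1 := by
    refine ball_subset_ball' ?_
    rw [mem_closedBall] at hx
    linarith [min_le_left ρ δ]
  refine (Complex.norm_fderiv_le_div_of_mapsTo_ball (R₂ := ε) (hF.differentiableOn.mono hball)
    (fun y hy => ?_) hm).trans ?_
  · exact (hunif y (ball_subset_closedBall (hball hy)) x
      (ball_subset_closedBall (hsub hx)) ((mem_ball.1 hy).trans_le (min_le_right _ _))).le
  · rcases min_choice ρ δ with h | h <;> rw [h]
    · linarith [div_pos hε hδ]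
    · linarith [div_pos hε hρ]

/-- Hölder dependence of solutions on the initial state, uniformly up to the boundary. -/
theorem exists_norm_solution_sub_le (hF : IsInwardField F c B) :
    ∃ A L, 0 ≤ A ∧ 0 ≤ L ∧ ∀ T γ₁ γ₂, IsPolydiscSolution F T γ₁ → IsPolydiscSolution F T γ₂ →
      ∀ η, 0 < η → ‖γ₁ 0 - γ₂ 0‖ ≤ η → ∀ t ∈ Icc 0 T,
        ‖γ₁ t - γ₂ t‖ ≤ A * √(η * (t + η)) * Real.exp (L * t) := by
  obtain ⟨M, hM0, hM⟩ := hF.exists_norm_le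
  obtain ⟨κ, hκ, -, hdecay⟩ := hF.exists_norm_solution_le
  -- With `κ / 4` the Lipschitz constant at distance `κ s/(1+s)` is `1/(4s) + 1/4 + C`. The barrier
  -- `β` below has logarithmic derivative `1/(2(s+η)) + L`, which is larger exactly when `s > η`.
  obtain ⟨C, hC, hlip⟩ := hF.exists_norm_sub_le (ε := κ / 4) (by positivity)
  refine ⟨8 * M + 1, 1 / 4 + C, by positivity, by positivity, ?_⟩
  intro T γ₁ γ₂ h₁ h₂ η hη h0 t ht
  set A := 8 * M + 1 with hA
  set L := 1 / 4 + C with hL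
  have hApos : 0 < A := by positivity
  set β : ℝ → ℝ := fun s => A * √(η * (s + η)) * Real.exp (L * s) with hβ
  have hβpos : ∀ s, 0 ≤ s → 0 < β s := fun s hs => by
    have : 0 < √(η * (s + η)) := Real.sqrt_pos.2 (by positivity)
    positivity
  have hder : ∀ s, 0 ≤ s → HasDerivAt β (β s * (1 / (2 * (s + η)) + L)) s := fun s hs => by
    have hp : 0 < η * (s + η) := by positivity
    have h1 : HasDerivAt (fun s : ℝ => η * (s + η)) η s := by
      simpa using ((hasDerivAt_id s).add_const η).const_mul η
    have h2 : HasDerivAt (fun s : ℝ => Real.exp (L * s)) (Real.exp (L * s) * L) s := by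
      simpa using ((hasDerivAt_id s).const_mul L).exp
    refine (((h1.sqrt hp.ne').const_mul A).mul h2).congr_deriv ?_
    have hq : √(η * (s + η)) ^ 2 = η * (s + η) := Real.sq_sqrt hp.le
    have hq0 : √(η * (s + η)) ≠ 0 := (Real.sqrt_pos.2 hp).ne'
    have hq1 : s + η ≠ 0 := by positivity
    have hq2 : η / (2 * √(η * (s + η))) = √(η * (s + η)) * (1 / (2 * (s + η))) := by
      field_simp; linarith
    simp only [hβ]
    rw [hq2]; ring
  refine image_norm_le_of_norm_deriv_right_lt_deriv_boundary' (a := 0) (b := T)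
    (f := fun s => γ₁ s - γ₂ s) (f' := fun s => F (γ₁ s) - F (γ₂ s)) (B := β)
    (B' := fun s => β s * (1 / (2 * (s + η)) + L))
    (h₁.continuousOn.sub h₂.continuousOn)
    (fun s hs => (h₁.deriv_Ici hs).sub (h₂.deriv_Ici hs)) ?_
    (fun s hs => (hder s hs.1).continuousAt.continuousWithinAt)
    (fun s hs => (hder s hs.1).hasDerivWithinAt) ?_ ht
  · have : β 0 = A * η := by simp [hβ, Real.sqrt_mul_self hη.le]
    rw [this]
    nlinarith [mul_nonneg hM0 hη.le]
  · intro s hs hEq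
    have hs' := Ico_subset_Icc_self hs
    have hb := hβpos s hs.1
    have hs0 := hs.1
    rcases le_or_gt s η with hsη | hsη
    -- For `s ≤ η` the Lipschitz bound is too weak, but the crude bound `2M` suffices: the barrier
    -- has slope at least `A / 4 = 2M + 1/4`.
    · have h3 : ‖F (γ₁ s) - F (γ₂ s)‖ ≤ 2 * M := by
        linarith [norm_sub_le (F (γ₁ s)) (F (γ₂ s)), hM _ (h₁.mapsTo hs'), hM _ (h₂.mapsTo hs')]
      have hsq : (s + η) / 2 ≤ √(η * (s + η)) := Real.le_sqrt_of_sq_le (by nlinarith)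
      have hexp : 1 ≤ Real.exp (L * s) := Real.one_le_exp (by positivity)
      have h4 : A * ((s + η) / 2) ≤ β s := by
        have : A * ((s + η) / 2) ≤ A * √(η * (s + η)) := by gcongr
        exact this.trans (le_mul_of_one_le_right (by positivity) hexp)
      have h5 : A / 4 ≤ β s * (1 / (2 * (s + η))) := by
        rw [mul_one_div, le_div_iff₀ (by positivity)]
        nlinarith
      have h6 : 0 ≤ β s * L := by positivity
      rw [mul_add]
      linarith
    · have hspos : 0 < s := hη.trans hsη
      have h3 := hlip (κ * (s / (1 + s))) (by positivity) (γ₁ s)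
        (mem_closedBall_zero_iff.2 (hdecay T γ₁ h₁ s hs')) (γ₂ s)
        (mem_closedBall_zero_iff.2 (hdecay T γ₂ h₂ s hs'))
      rw [hEq] at h3
      refine h3.trans_lt ?_
      rw [mul_comm]
      refine mul_lt_mul_of_pos_left ?_ hb
      have h7 : κ / 4 / (κ * (s / (1 + s))) = 1 / (4 * s) + 1 / 4 := by
        field_simp
      have h8 : 1 / (4 * s) < 1 / (2 * (s + η)) :=
        one_div_lt_one_div_of_lt (by positivity) (by linarith)
      rw [h7, hL]
      linarith

/-- Solutions on `[0, T]` depend uniformly continuously on the initial state. -/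
theorem exists_solution_dist_lt (hF : IsInwardField F c B) (T : ℝ) {ε : ℝ} (hε : 0 < ε) :
    ∃ δ, 0 < δ ∧ ∀ γ₁ γ₂, IsPolydiscSolution F T γ₁ → IsPolydiscSolution F T γ₂ →
      ‖γ₁ 0 - γ₂ 0‖ ≤ δ → ∀ t ∈ Icc 0 T, ‖γ₁ t - γ₂ t‖ < ε := by
  obtain ⟨A, L, hA, hL, h⟩ := hF.exists_norm_solution_sub_le
  have hcont : Continuous fun η : ℝ => A * √(η * (T + η)) * Real.exp (L * T) := by fun_prop
  have hlim := hcont.tendsto 0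
  simp only [zero_mul, Real.sqrt_zero, mul_zero] at hlim
  obtain ⟨δ, hδ⟩ := ((hlim.eventually (gt_mem_nhds hε)).filter_mono
    (nhdsWithin_le_nhds (s := Ioi 0)) |>.and self_mem_nhdsWithin).exists
  have hδ0 : 0 < δ := hδ.2
  refine ⟨δ, hδ0, fun γ₁ γ₂ h₁ h₂ h0 t ht => lt_of_le_of_lt ?_ hδ.1⟩
  refine (h T γ₁ γ₂ h₁ h₂ δ hδ0 h0 t ht).trans ?_
  have := ht.2
  gcongr

/-- Equal initial states are within every `δ`, so the gap is smaller than any `ε`, in particular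
than itself. -/
theorem solution_unique (hF : IsInwardField F c B) {T : ℝ} {γ₁ γ₂ : ℝ → (Fin n → ℂ)}
    (h₁ : IsPolydiscSolution F T γ₁) (h₂ : IsPolydiscSolution F T γ₂) (h0 : γ₁ 0 = γ₂ 0) :
    EqOn γ₁ γ₂ (Icc 0 T) := by
  intro t ht
  by_contra hne
  obtain ⟨δ, hδ, h⟩ := hF.exists_solution_dist_lt T (norm_pos_iff.2 (sub_ne_zero.2 hne))
  exact lt_irrefl _ (h γ₁ γ₂ h₁ h₂ (by simp [h0, hδ.le]) t ht)

end IsInwardField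

/-! ### Existence of solutions and the semiflow -/

namespace IsInwardField

variable {n : ℕ} {F : (Fin n → ℂ) → (Fin n → ℂ)} {c B : ℝ}

/-- Slightly smaller concentric polydiscs are forward invariant, and solutions exist there. -/
theorem exists_solution_mapsTo_closedBall (hF : IsInwardField F c B) {r : ℝ} (hr0 : 0 < r)
    (hr1 : r < 1) (hr : B * (1 - r ^ 2) ≤ c) {T : ℝ} (hT : 0 ≤ T) {z : Fin n → ℂ}
    (hz : z ∈ closedBall 0 r) :
    ∃ γ, γ 0 = z ∧ IsPolydiscSolution F T γ ∧ MapsTo γ (Icc 0 T) (closedBall 0 r) := by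
  obtain ⟨M, hM0, hM⟩ := hF.exists_norm_le
  obtain ⟨C, hC, hlip⟩ := hF.exists_norm_sub_le one_pos
  have hc := hF.pos
  -- Precomposing `F` with the coordinatewise retraction makes it globally Lipschitz and bounded, so
  -- Picard–Lindelöf reaches time `T` at once. The solution never leaves the polydisc of radius `r`,
  -- where `P` is the identity.
  set P : (Fin n → ℂ) → (Fin n → ℂ) := fun x j => discRetract r (x j) with hP
  have hPr : ∀ x, P x ∈ closedBall (0 : Fin n → ℂ) r := fun x =>
    mem_closedBall_zero_iff.2
      ((pi_norm_le_iff_of_nonneg hr0.le).2 fun j => norm_discRetract_le hr0 _)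
  have hP1 : ∀ x, P x ∈ closedBall (0 : Fin n → ℂ) 1 := fun x =>
    closedBall_subset_closedBall hr1.le (hPr x)
  have hPlip : ∀ x y, ‖P x - P y‖ ≤ 2 * ‖x - y‖ := fun x y =>
    (pi_norm_le_iff_of_nonneg (by positivity)).2 fun j =>
      (norm_discRetract_sub_le hr0 _ _).trans
        (mul_le_mul_of_nonneg_left (norm_le_pi_norm (x - y) j) zero_le_two)
  have hρ : 0 < 1 - r := by linarith
  lift M to ℝ≥0 using hM0
  obtain ⟨K, hK⟩ : ∃ K : ℝ≥0, (K : ℝ) = (1 / (1 - r) + C) * 2 :=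
    CanLift.prf _ (by positivity : 0 ≤ (1 / (1 - r) + C) * 2)
  have hgl : LipschitzWith K (fun x => F (P x)) :=
    LipschitzWith.of_dist_le_mul fun x y => by
      rw [dist_eq_norm, dist_eq_norm, hK, mul_assoc]
      refine (hlip (1 - r) hρ (P x) (by simpa using hPr x) (P y) (by simpa using hPr y)).trans ?_
      exact mul_le_mul_of_nonneg_left (hPlip x y) (by positivity)
  have hPL : IsPicardLindelof (fun _ x => F (P x)) (⟨0, le_rfl, hT⟩ : Icc (0 : ℝ) T) z
      (M * T.toNNReal) 0 M K :=
    ⟨fun _ _ => hgl.lipschitzOnWith, fun _ _ => continuousOn_const, fun _ _ x _ => hM _ (hP1 x),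
      by simp [hT]⟩
  obtain ⟨γ, hγ0, hγ⟩ := hPL.exists_eq_forall_mem_Icc_hasDerivWithinAt₀
  have hγ0 : γ 0 = z := hγ0
  have hcoord : ∀ t ∈ Icc 0 T, ∀ j, ‖γ t j‖ ≤ r := fun t ht j => by
    have hsq : ‖γ t j‖ ^ 2 ≤ r ^ 2 := by
      refine image_le_of_deriv_right_lt_deriv_boundary' (a := 0) (b := T)
        (f := fun s => ‖γ s j‖ ^ 2)
        (f' := fun s => 2 * ((starRingEnd ℂ) (γ s j) * F (P (γ s)) j).re)
        (B := fun _ => r ^ 2) (B' := fun _ => 0)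
        (fun s hs => ((hγ s hs).norm_sq_apply j).continuousWithinAt)
        (fun s hs => ((hγ s (Ico_subset_Icc_self hs)).mono_of_mem_nhdsWithin
          (Icc_mem_nhdsGE_of_mem hs)).norm_sq_apply j) ?_
        continuousOn_const (fun s hs => hasDerivWithinAt_const _ _ _) ?_ ht
      · have := (norm_le_pi_norm z j).trans (mem_closedBall_zero_iff.1 hz)
        rw [hγ0]
        exact pow_le_pow_left₀ (norm_nonneg _) this 2
      · intro s hs hEq
        have hnorm : ‖γ s j‖ = r := by
          rwa [sq_eq_sq₀ (norm_nonneg _) hr0.le] at hEq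
        -- At contact `P` fixes the `j`-th coordinate, whatever it does to the others, and the
        -- inward bound at `P (γ s)` involves only that coordinate.
        have hPj : P (γ s) j = γ s j := discRetract_of_norm_le hr0 hnorm.le
        have := hF.re_le _ (hP1 (γ s)) j
        rw [hPj, hnorm] at this
        linarith
    exact le_of_sq_le_sq hsq hr0.le
  have hPγ : ∀ t ∈ Icc 0 T, P (γ t) = γ t := fun t ht =>
    funext fun j => discRetract_of_norm_le hr0 (hcoord t ht j)
  have hmaps : MapsTo γ (Icc 0 T) (closedBall 0 r) := fun t ht => by
    rw [← hPγ t ht]; exact hPr _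
  refine ⟨γ, hγ0, ⟨hmaps.mono_right (closedBall_subset_closedBall hr1.le), fun t ht => ?_⟩, hmaps⟩
  have := hγ t ht
  rwa [hPγ t ht] at this

/-- At `r = 1` the left side `B * (1 - r ^ 2)` vanishes, so by continuity every `r` close to 1
leaves an inward slack of `c`. -/
theorem exists_invariant_radius (hF : IsInwardField F c B) {s : ℝ} (hs : s < 1) :
    ∃ r, 0 < r ∧ s < r ∧ r < 1 ∧ B * (1 - r ^ 2) ≤ c := by
  have hc := hF.pos
  have hcont : ContinuousAt (fun r : ℝ => B * (1 - r ^ 2)) 1 := by fun_prop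
  have h1 : ∀ᶠ r : ℝ in 𝓝 1, B * (1 - r ^ 2) < c :=
    hcont.eventually (gt_mem_nhds (by simpa using hc))
  obtain ⟨r, ⟨⟨hr, hr0⟩, hrs⟩, hr1⟩ := (((h1.and (lt_mem_nhds one_pos)).and
    (lt_mem_nhds hs)).filter_mono (nhdsWithin_le_nhds (s := Iio 1)) |>.and
      self_mem_nhdsWithin).exists
  exact ⟨r, hr0, hrs, hr1, hr.le⟩

theorem exists_solution_of_mem_ball (hF : IsInwardField F c B) {T : ℝ} (hT : 0 ≤ T)
    {z : Fin n → ℂ} (hz : z ∈ ball 0 1) : ∃ γ, γ 0 = z ∧ IsPolydiscSolution F T γ := by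
  obtain ⟨r, hr0, hzr, hr1, hr⟩ := hF.exists_invariant_radius (mem_ball_zero_iff.1 hz)
  obtain ⟨γ, h0, hγ, -⟩ := hF.exists_solution_mapsTo_closedBall hr0 hr1 hr hT
    (mem_closedBall_zero_iff.2 hzr.le)
  exact ⟨γ, h0, hγ⟩

/-- A solution satisfies the integral equation. -/
theorem solution_eq_picard (hF : IsInwardField F c B) {T : ℝ} {γ : ℝ → (Fin n → ℂ)}
    (h : IsPolydiscSolution F T γ) {t : ℝ} (ht : t ∈ Icc 0 T) :
    ODE.picard (fun _ => F) 0 (γ 0) γ t = γ t := by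
  have h' := h.mono ht.2
  refine ODE.picard_eq_of_hasDerivAt (u := closedBall 0 1)
    (hF.continuousOn.comp continuousOn_snd fun p hp => hp.2) ?_ ?_ <;> rw [uIcc_of_le ht.1]
  · exact h'.deriv
  · exact h'.mapsTo

/-- A pointwise limit of solutions which is uniform in time is a solution. -/
theorem solution_of_tendstoUniformlyOn (hF : IsInwardField F c B) {T : ℝ} (hT : 0 ≤ T)
    {γ : ℕ → ℝ → (Fin n → ℂ)} {δ : ℝ → (Fin n → ℂ)} (h : ∀ k, IsPolydiscSolution F T (γ k))
    (hδ : TendstoUniformlyOn γ δ atTop (Icc 0 T)) : IsPolydiscSolution F T δ := by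
  obtain ⟨M, hM0, hM⟩ := hF.exists_norm_le
  have hmaps : MapsTo δ (Icc 0 T) (closedBall 0 1) := fun t ht =>
    isClosed_closedBall.mem_of_tendsto (hδ.tendsto_at ht)
      (Eventually.of_forall fun k => (h k).mapsTo ht)
  have hcont : ContinuousOn δ (Icc 0 T) :=
    hδ.continuousOn (Eventually.of_forall fun k => (h k).continuousOn).frequently
  have hunc : ContinuousOn (Function.uncurry fun _ : ℝ => F) (Icc 0 T ×ˢ closedBall 0 1) :=
    hF.continuousOn.comp continuousOn_snd fun p hp => hp.2
  -- The limit is taken in the integral equation, by dominated convergence; differentiating then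
  -- recovers the equation.
  have hint : EqOn δ (ODE.picard (fun _ => F) 0 (δ 0) δ) (Icc 0 T) := fun t ht => by
    have h0 : (0 : ℝ) ∈ Icc 0 T := ⟨le_rfl, hT⟩
    have hsub : uIoc 0 t ⊆ Icc 0 T := by
      rw [uIoc_of_le ht.1]
      exact fun s hs => ⟨hs.1.le, hs.2.trans ht.2⟩
    refine tendsto_nhds_unique (hδ.tendsto_at ht) ?_
    have hlim : Tendsto (fun k => γ k 0 + ∫ s in (0 : ℝ)..t, F (γ k s)) atTop
        (𝓝 (δ 0 + ∫ s in (0 : ℝ)..t, F (δ s))) := by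
      refine (hδ.tendsto_at h0).add
        (intervalIntegral.tendsto_integral_filter_of_dominated_convergence (fun _ => M) ?_ ?_
          intervalIntegrable_const ?_)
      · refine Eventually.of_forall fun k => ContinuousOn.aestronglyMeasurable ?_ measurableSet_uIoc
        exact hF.continuousOn.comp ((h k).continuousOn.mono hsub) ((h k).mapsTo.mono_left hsub)
      · exact Eventually.of_forall fun k => MeasureTheory.ae_of_all _ fun s hs =>
          hM _ ((h k).mapsTo (hsub hs))
      · refine MeasureTheory.ae_of_all _ fun s hs => ?_
        exact (hF.continuousOn _ (hmaps (hsub hs))).tendsto.comp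
          (tendsto_nhdsWithin_iff.2 ⟨hδ.tendsto_at (hsub hs),
            Eventually.of_forall fun k => (h k).mapsTo (hsub hs)⟩)
    exact hlim.congr fun k => hF.solution_eq_picard (h k) ht
  refine ⟨hmaps, fun t ht => ?_⟩
  exact (ODE.hasDerivWithinAt_picard_Icc ⟨le_rfl, hT⟩ hunc hcont hmaps (δ 0) ht).congr hint (hint ht)

/-- Scale `z` into the open polydisc and solve there. The solutions are uniformly Cauchy in time
because dependence on initial states is uniform up to the boundary. -/
theorem exists_solution (hF : IsInwardField F c B) {T : ℝ} (hT : 0 ≤ T) {z : Fin n → ℂ}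
    (hz : z ∈ closedBall 0 1) : ∃ γ, γ 0 = z ∧ IsPolydiscSolution F T γ := by
  have hlt : ∀ k : ℕ, 0 < 1 - 1 / ((k : ℝ) + 2) ∧ 1 - 1 / ((k : ℝ) + 2) < 1 := fun k => by
    have h1 : 0 < 1 / ((k : ℝ) + 2) := by positivity
    have h2 : 1 / ((k : ℝ) + 2) < 1 := by rw [div_lt_one (by positivity)]; linarith
    constructor <;> linarith
  set p : ℕ → (Fin n → ℂ) := fun k => (1 - 1 / ((k : ℝ) + 2)) • z with hp
  have hpb : ∀ k, p k ∈ ball (0 : Fin n → ℂ) 1 := fun k => by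
    rw [mem_ball_zero_iff, hp, norm_smul, Real.norm_of_nonneg (hlt k).1.le]
    have := mem_closedBall_zero_iff.1 hz
    nlinarith [hlt k, norm_nonneg z]
  have hlim : Tendsto p atTop (𝓝 z) := by
    have h1 : Tendsto (fun k : ℕ => 1 - 1 / ((k : ℝ) + 2)) atTop (𝓝 (1 - 0)) :=
      tendsto_const_nhds.sub (tendsto_const_nhds.div_atTop
        (tendsto_atTop_add_const_right _ _ tendsto_natCast_atTop_atTop))
    simpa [hp] using h1.smul_const z
  choose γ h0 hγ using fun k => hF.exists_solution_of_mem_ball hT (hpb k)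
  have hcauchy : UniformCauchySeqOn γ atTop (Icc 0 T) := by
    rw [Metric.uniformCauchySeqOn_iff]
    intro ε hε
    obtain ⟨δ, hδ, hdist⟩ := hF.exists_solution_dist_lt T hε
    obtain ⟨N, hN⟩ := Metric.cauchySeq_iff.1 hlim.cauchySeq δ hδ
    refine ⟨N, fun m hm k hk t ht => ?_⟩
    rw [dist_eq_norm]
    refine hdist _ _ (hγ m) (hγ k) ?_ t ht
    rw [h0, h0, ← dist_eq_norm]
    exact (hN m hm k hk).le
  choose! δ hδ using fun t (ht : t ∈ Icc 0 T) => cauchySeq_tendsto_of_complete (hcauchy.cauchySeq ht)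
  refine ⟨δ, ?_, hF.solution_of_tendstoUniformlyOn hT hγ (hcauchy.tendstoUniformlyOn_of_tendsto hδ)⟩
  refine tendsto_nhds_unique (hδ 0 ⟨le_rfl, hT⟩) ?_
  simpa only [h0] using hlim

/-- The semiflow on the closed polydisc. -/
theorem exists_semiflow (hF : IsInwardField F c B) :
    ∃ φ : ℝ → (Fin n → ℂ) → (Fin n → ℂ), ∀ z ∈ closedBall (0 : Fin n → ℂ) 1,
      φ 0 z = z ∧ ∀ T, IsPolydiscSolution F T (fun t => φ t z) := by
  choose! σ h0 hσ using fun T (hT : 0 ≤ T) z (hz : z ∈ closedBall (0 : Fin n → ℂ) 1) =>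
    hF.exists_solution hT hz
  -- The value at time `t` is the endpoint of a solution chosen on `[0, t]`; uniqueness makes these
  -- choices agree. For `T < 0` the interval is empty.
  refine ⟨fun t z => σ t z t, fun z hz => ⟨h0 0 le_rfl z hz, fun T => ?_⟩⟩
  rcases lt_or_ge T 0 with hT | hT
  · exact ⟨by simp [hT, mapsTo_empty], by simp [hT]⟩
  · refine (hσ T hT z hz).congr fun t ht => ?_
    exact hF.solution_unique (hσ t ht.1 z hz) ((hσ T hT z hz).mono ht.2)
      ((h0 t ht.1 z hz).trans (h0 T hT z hz).symm) ⟨ht.1, le_rfl⟩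

end IsInwardField

/-! ### Euler scheme and holomorphy of the time-`t` maps -/

/-- One step of length `h` of the explicit Euler scheme for `x' = F x`. -/
noncomputable def eulerStep {n : ℕ} (F : (Fin n → ℂ) → (Fin n → ℂ)) (h : ℝ) (z : Fin n → ℂ) : Fin n → ℂ :=
  z + h • F z

theorem IsPolydiscSolution.norm_sub_le {n : ℕ} {F : (Fin n → ℂ) → (Fin n → ℂ)} {T M : ℝ}
    {γ : ℝ → (Fin n → ℂ)} (h : IsPolydiscSolution F T γ)
    (hM : ∀ z ∈ closedBall (0 : Fin n → ℂ) 1, ‖F z‖ ≤ M) {s t : ℝ} (hs : s ∈ Icc 0 T)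
    (ht : t ∈ Icc 0 T) : ‖γ t - γ s‖ ≤ M * |t - s| :=
  (convex_Icc 0 T).norm_image_sub_le_of_norm_hasDerivWithin_le h.deriv
    (fun _ hx => hM _ (h.mapsTo hx)) hs ht

namespace IsInwardField

variable {n : ℕ} {F : (Fin n → ℂ) → (Fin n → ℂ)} {c B : ℝ}

/-- In the expansion of `|z_j + h F_j|^2` the slack `c` at radius `r` contributes `-2hc`, which
absorbs `h^2 M^2`. What remains is at most `|z_j|^2 + 2hB (r^2 - |z_j|^2)`, which is at most `r^2`
as `2hB ≤ 1`. -/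
theorem mapsTo_eulerStep (hF : IsInwardField F c B) {M r h : ℝ}
    (hM : ∀ z ∈ closedBall (0 : Fin n → ℂ) 1, ‖F z‖ ≤ M) (hr0 : 0 < r) (hr1 : r < 1)
    (hr : B * (1 - r ^ 2) ≤ c) (h0 : 0 ≤ h) (hB : h * (2 * B) ≤ 1) (hMc : h * M ^ 2 ≤ 2 * c) :
    MapsTo (eulerStep F h) (closedBall 0 r) (closedBall 0 r) := by
  intro z hz
  have hz1 : z ∈ closedBall (0 : Fin n → ℂ) 1 := closedBall_subset_closedBall hr1.le hz
  refine mem_closedBall_zero_iff.2 ((pi_norm_le_iff_of_nonneg hr0.le).2 fun j => ?_)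
  refine le_of_sq_le_sq ?_ hr0.le
  have hzj : ‖z j‖ ^ 2 ≤ r ^ 2 := pow_le_pow_left₀ (norm_nonneg _)
    ((norm_le_pi_norm z j).trans (mem_closedBall_zero_iff.1 hz)) 2
  have hFj : ‖F z j‖ ^ 2 ≤ M ^ 2 := pow_le_pow_left₀ (norm_nonneg _)
    ((norm_le_pi_norm (F z) j).trans (hM z hz1)) 2
  have hre := hF.re_le z hz1 j
  have hexpand : ‖eulerStep F h z j‖ ^ 2 =
      ‖z j‖ ^ 2 + 2 * (h * ((starRingEnd ℂ) (z j) * F z j).re) + h ^ 2 * ‖F z j‖ ^ 2 := by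
    rw [eulerStep, Pi.add_apply, Pi.smul_apply, norm_add_sq_real, inner_smul_right, Complex.inner,
      norm_smul, mul_pow, Real.norm_eq_abs, sq_abs, mul_comm (F z j)]
  rw [hexpand]
  have h1 := mul_le_mul_of_nonneg_left hre h0
  have h2 := mul_le_mul_of_nonneg_left hFj (sq_nonneg h)
  have h3 := mul_le_mul_of_nonneg_left hMc h0
  have h4 := mul_le_mul_of_nonneg_left hr h0
  have h5 := mul_le_mul_of_nonneg_right hB (sub_nonneg.2 hzj)
  nlinarith

/-- The error of the explicit Euler scheme. -/
theorem norm_solution_sub_eulerStep_iterate_le {M L r T h : ℝ} {γ : ℝ → (Fin n → ℂ)}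
    (hM : ∀ z ∈ closedBall (0 : Fin n → ℂ) 1, ‖F z‖ ≤ M) (hL0 : 0 ≤ L)
    (hL : ∀ z ∈ closedBall (0 : Fin n → ℂ) r, ∀ w ∈ closedBall (0 : Fin n → ℂ) r,
      ‖F z - F w‖ ≤ L * ‖z - w‖)
    (hE : MapsTo (eulerStep F h) (closedBall 0 r) (closedBall 0 r)) (h0 : 0 ≤ h)
    (hγ : IsPolydiscSolution F T γ) (hγr : MapsTo γ (Icc 0 T) (closedBall 0 r)) (k : ℕ)
    (hk : k * h ≤ T) :
    ‖γ (k * h) - (eulerStep F h)^[k] (γ 0)‖ ≤ L * M * h ^ 2 * k * Real.exp (L * h * k) := by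
  induction k with
  | zero => simp
  | succ k ih =>
    push_cast at hk ⊢
    have hkh : (k : ℝ) * h ≤ T := by linarith
    have hk0 : 0 ≤ (k : ℝ) * h := by positivity
    have ih := ih hkh
    have hkmem : (k : ℝ) * h ∈ Icc 0 T := ⟨hk0, hkh⟩
    have hM0 : 0 ≤ M := (norm_nonneg _).trans (hM _ (hγ.mapsTo hkmem))
    set a : ℝ := k * h with ha
    have hab : a ≤ (k + 1) * h := by linarith
    have hsub : Icc a ((k + 1) * h) ⊆ Icc 0 T := Icc_subset_Icc hk0 hk
    have hγ0 : γ 0 ∈ closedBall (0 : Fin n → ℂ) r := hγr ⟨le_rfl, hk0.trans hkh⟩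
    -- Local error: subtracting `s • F (γ a)` leaves derivative `F (γ s) - F (γ a)`, of size at most
    -- `L * (M * h)` over a step of length `h`.
    have hlocal : ‖γ ((k + 1) * h) - eulerStep F h (γ a)‖ ≤ L * M * h ^ 2 := by
      have := norm_image_sub_le_of_norm_deriv_le_segment' (a := a) (b := (k + 1) * h)
        (f := fun s => γ s - s • F (γ a)) (f' := fun s => F (γ s) - F (γ a)) (C := L * (M * h))
        (fun s hs => by
          simpa using ((hγ.deriv s (hsub hs)).mono hsub).fun_sub
            ((hasDerivWithinAt_id s _).smul_const (F (γ a))))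
        (fun s hs => by
          have hs' := hsub (Ico_subset_Icc_self hs)
          refine (hL _ (hγr hs') _ (hγr hkmem)).trans (mul_le_mul_of_nonneg_left ?_ hL0)
          refine (hγ.norm_sub_le hM hkmem hs').trans (mul_le_mul_of_nonneg_left ?_ hM0)
          rw [abs_of_nonneg (by linarith [hs.1])]
          linarith [hs.2])
        ((k + 1) * h) (right_mem_Icc.2 hab)
      have he : γ ((k + 1) * h) - ((k + 1) * h) • F (γ a) - (γ a - a • F (γ a)) =
          γ ((k + 1) * h) - eulerStep F h (γ a) := by
        rw [eulerStep, show ((k : ℝ) + 1) * h = a + h by rw [ha]; ring, add_smul]; abel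
      simp only [he] at this
      refine this.trans (le_of_eq ?_)
      rw [ha]; ring
    have hstep : ‖eulerStep F h (γ a) - eulerStep F h ((eulerStep F h)^[k] (γ 0))‖ ≤
        Real.exp (L * h) * ‖γ a - (eulerStep F h)^[k] (γ 0)‖ := by
      set w := (eulerStep F h)^[k] (γ 0)
      have hw : w ∈ closedBall (0 : Fin n → ℂ) r := hE.iterate k hγ0
      calc ‖eulerStep F h (γ a) - eulerStep F h w‖
          = ‖(γ a - w) + h • (F (γ a) - F w)‖ := by
            congr 1; simp only [eulerStep, smul_sub]; abel
        _ ≤ ‖γ a - w‖ + h * (L * ‖γ a - w‖) := by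
            refine (norm_add_le _ _).trans ?_
            rw [norm_smul, Real.norm_of_nonneg h0]
            gcongr
            exact hL _ (hγr hkmem) _ hw
        _ = (L * h + 1) * ‖γ a - w‖ := by ring
        _ ≤ Real.exp (L * h) * ‖γ a - w‖ := by
            gcongr
            exact Real.add_one_le_exp _
    rw [Function.iterate_succ_apply']
    have hexp : Real.exp (L * h * (k + 1)) = Real.exp (L * h) * Real.exp (L * h * k) := by
      rw [← Real.exp_add]; ring_nf
    have hone : 1 ≤ Real.exp (L * h * (k + 1)) := Real.one_le_exp (by positivity)
    have hP : 0 ≤ L * M * h ^ 2 := by positivity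
    calc ‖γ ((k + 1) * h) - eulerStep F h ((eulerStep F h)^[k] (γ 0))‖
        ≤ ‖γ ((k + 1) * h) - eulerStep F h (γ a)‖ +
          ‖eulerStep F h (γ a) - eulerStep F h ((eulerStep F h)^[k] (γ 0))‖ :=
          norm_sub_le_norm_sub_add_norm_sub _ _ _
      _ ≤ L * M * h ^ 2 * 1 +
          Real.exp (L * h) * (L * M * h ^ 2 * k * Real.exp (L * h * k)) := by
          rw [mul_one]
          exact add_le_add hlocal (hstep.trans (mul_le_mul_of_nonneg_left ih (Real.exp_nonneg _)))
      _ ≤ L * M * h ^ 2 * Real.exp (L * h * (k + 1)) +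
          Real.exp (L * h) * (L * M * h ^ 2 * k * Real.exp (L * h * k)) := by gcongr
      _ = L * M * h ^ 2 * (k + 1) * Real.exp (L * h * (k + 1)) := by rw [hexp]; ring

/-- The time-`t` map of the semiflow is holomorphic, as a uniform limit of Euler iterates. -/
theorem differentiableOn_semiflow (hF : IsInwardField F c B)
    {φ : ℝ → (Fin n → ℂ) → (Fin n → ℂ)} (hφ : ∀ z ∈ closedBall (0 : Fin n → ℂ) 1,
      φ 0 z = z ∧ ∀ T, IsPolydiscSolution F T (fun t => φ t z)) {t : ℝ} (ht : 0 ≤ t) :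
    DifferentiableOn ℂ (φ t) (ball 0 1) := by
  intro z hz
  refine DifferentiableAt.differentiableWithinAt ?_
  obtain ⟨M, hM0, hM⟩ := hF.exists_norm_le
  obtain ⟨C, hC, hlip⟩ := hF.exists_norm_sub_le one_pos
  obtain ⟨r, hr0, hzr, hr1, hr⟩ := hF.exists_invariant_radius (mem_ball_zero_iff.1 hz)
  have hρ : 0 < 1 - r := by linarith
  set L := 1 / (1 - r) + C with hL
  have hL0 : 0 ≤ L := by positivity
  have hLr : ∀ z ∈ closedBall (0 : Fin n → ℂ) r, ∀ w ∈ closedBall (0 : Fin n → ℂ) r,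
      ‖F z - F w‖ ≤ L * ‖z - w‖ := by
    simpa only [sub_sub_cancel] using hlip (1 - r) hρ
  have hγr : ∀ w ∈ closedBall (0 : Fin n → ℂ) r,
      MapsTo (fun s => φ s w) (Icc 0 t) (closedBall 0 r) := fun w hw => by
    obtain ⟨γ, h0, hγ, hmaps⟩ := hF.exists_solution_mapsTo_closedBall hr0 hr1 hr ht hw
    obtain ⟨h0', hφ'⟩ := hφ w (closedBall_subset_closedBall hr1.le hw)
    exact hmaps.congr (hF.solution_unique hγ (hφ' t) (h0.trans h0'.symm))
  have hstep : Tendsto (fun m : ℕ => t / ((m : ℝ) + 1)) atTop (𝓝 0) :=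
    tendsto_const_nhds.div_atTop
      (tendsto_atTop_add_const_right _ _ tendsto_natCast_atTop_atTop)
  have hev : ∀ᶠ m : ℕ in atTop, t / ((m : ℝ) + 1) * (2 * B) ≤ 1 ∧
      t / ((m : ℝ) + 1) * M ^ 2 ≤ 2 * c := by
    have hc := hF.pos
    have h1 := (hstep.mul_const (2 * B)).eventually (ge_mem_nhds (by rw [zero_mul]; exact one_pos))
    have h2 := (hstep.mul_const (M ^ 2)).eventually
      (ge_mem_nhds (show 0 * M ^ 2 < 2 * c by rw [zero_mul]; positivity))
    exact h1.and h2
  obtain ⟨N, hN⟩ := eventually_atTop.1 hev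
  -- The shift by `N` makes every step short enough for invariance; `m + N + 1` steps of this length
  -- end exactly at `t`.
  set h : ℕ → ℝ := fun m => t / (((m + N : ℕ) : ℝ) + 1) with hh
  have hh0 : ∀ m, 0 ≤ h m := fun m => by positivity
  have hE : ∀ m, MapsTo (eulerStep F (h m)) (closedBall 0 r) (closedBall 0 r) := fun m =>
    hF.mapsTo_eulerStep hM hr0 hr1 hr (hh0 m) (hN (m + N) (Nat.le_add_left _ _)).1
      (hN (m + N) (Nat.le_add_left _ _)).2
  have hmh : ∀ m, ((m + N + 1 : ℕ) : ℝ) * h m = t := fun m => by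
    simp only [hh]; push_cast; field_simp
  have hball : ball z (r - ‖z‖) ⊆ closedBall 0 r :=
    (ball_subset_ball' (by rw [dist_zero_right]; linarith)).trans ball_subset_closedBall
  refine TendstoUniformlyOn.differentiableAt_complex (ρ := r - ‖z‖) (by linarith)
    (f := fun m => (eulerStep F (h m))^[m + N + 1]) ?_ fun m => ?_
  · have herr : Tendsto (fun m : ℕ => L * M * h m * t * Real.exp (L * t)) atTop (𝓝 0) := by
      have := (((hstep.comp (tendsto_add_atTop_nat N)).const_mul (L * M)).mul_const t).mul_const
        (Real.exp (L * t))
      simpa [hh, Function.comp_def] using this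
    rw [Metric.tendstoUniformlyOn_iff]
    intro ε hε
    filter_upwards [herr.eventually (gt_mem_nhds hε)] with m hm w hw
    obtain ⟨h0, hsol⟩ := hφ w (closedBall_subset_closedBall hr1.le (hball hw))
    have := norm_solution_sub_eulerStep_iterate_le hM hL0 hLr (hE m) (hh0 m) (hsol t)
      (hγr w (hball hw)) (m + N + 1) (hmh m).le
    rw [hmh, h0] at this
    rw [dist_eq_norm]
    refine this.trans_lt (lt_of_eq_of_lt ?_ hm)
    rw [mul_assoc L (h m), mul_comm (h m), hmh, mul_assoc (L * M), sq, mul_assoc (h m),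
      mul_comm (h m) ((m + N + 1 : ℕ) : ℝ), hmh]
    ring
  · have hd : DifferentiableOn ℂ (eulerStep F (h m)) (closedBall 0 r) :=
      differentiableOn_id.add ((hF.differentiableOn.mono
        (closedBall_subset_ball hr1)).const_smul (h m))
    exact (hd.iterate (hE m) _).mono hball

end IsInwardField

/-! ### From inward fields to the flow on polydisc and torus -/

theorem openPolydisc_eq_ball (ι : Type) [Fintype ι] : openPolydisc ι = ball 0 1 := by
  ext z
  simp [openPolydisc, pi_norm_lt_iff]

theorem closedPolydisc_eq_closedBall (ι : Type) [Fintype ι] :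
    closedPolydisc ι = closedBall 0 1 := by
  ext z
  simp [closedPolydisc, pi_norm_le_iff_of_nonneg]

theorem unitTorus_subset_closedPolydisc (ι : Type) : unitTorus ι ⊆ closedPolydisc ι :=
  fun _ hz k => (hz k).le

namespace IsInwardField

variable {n : ℕ} {F : (Fin n → ℂ) → (Fin n → ℂ)} {c B : ℝ}

/-- The semiflow restricts to every set between the open and the closed polydisc. -/
theorem generatesFlowOn (hF : IsInwardField F c B)
    {φ : ℝ → (Fin n → ℂ) → (Fin n → ℂ)} (hφ : ∀ z ∈ closedBall (0 : Fin n → ℂ) 1,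
      φ 0 z = z ∧ ∀ T, IsPolydiscSolution F T (fun t => φ t z)) {S : Set (Fin n → ℂ)}
    (hS : S ⊆ closedBall 0 1) (hbS : ball 0 1 ⊆ S) : GeneratesFlowOn F S φ := by
  obtain ⟨κ, hκ0, -, hκ⟩ := hF.exists_norm_solution_le
  obtain ⟨M, hM0, hM⟩ := hF.exists_norm_le
  have hmaps : ∀ t : ℝ, 0 ≤ t → MapsTo (φ t) S S := fun t ht z hz => by
    rcases ht.eq_or_lt with rfl | hpos
    · rwa [(hφ z (hS hz)).1]
    -- At positive times every solution is in the open polydisc, so any intermediate `S` is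
    -- preserved.
    · have hle := hκ t _ ((hφ z (hS hz)).2 t) t ⟨ht, le_rfl⟩
      refine hbS (mem_ball_zero_iff.2 ?_)
      have : 0 < κ * (t / (1 + t)) := by positivity
      linarith
  refine ⟨hmaps, fun z hz => (hφ z (hS hz)).1, fun t s ht hs z hz => ?_, ?_, fun z hz t ht => ?_,
    fun z hz T γ hγ h0 hd => ?_⟩
  · have hw := hS (hmaps s hs hz)
    have h₁ := ((hφ z (hS hz)).2 (t + s)).comp_add hs le_rfl
    refine hF.solution_unique h₁ ((hφ _ hw).2 t) ?_ ⟨ht, le_rfl⟩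
    simp only [zero_add]
    exact (hφ _ hw).1.symm
  · rintro ⟨t, z⟩ ⟨ht, hz⟩
    rw [Metric.continuousWithinAt_iff]
    intro ε hε
    -- Joint continuity: dependence on the state is uniform over `[0, t + 1]`, and each trajectory
    -- has speed at most `M`.
    obtain ⟨δ, hδ, hdep⟩ := hF.exists_solution_dist_lt (t + 1) (half_pos hε)
    refine ⟨min δ (min 1 (ε / (2 * (M + 1)))), by positivity, ?_⟩
    rintro ⟨s, w⟩ ⟨hs, hw⟩ hd
    simp only [lt_min_iff, Prod.dist_eq, max_lt_iff] at hd
    obtain ⟨⟨-, hwz⟩, ⟨hst1, -⟩, ⟨hst, -⟩⟩ := hd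
    rw [mem_Ici] at ht hs
    rw [Real.dist_eq] at hst1 hst
    obtain ⟨hz0, hzs⟩ := hφ z (hS hz)
    obtain ⟨hw0, hws⟩ := hφ w (hS hw)
    have hsI : s ∈ Icc 0 (t + 1) := ⟨hs, by linarith [(abs_lt.1 hst1).2]⟩
    have h1 : ‖φ s w - φ s z‖ < ε / 2 := by
      refine hdep _ _ (hws (t + 1)) (hzs (t + 1)) ?_ s hsI
      rw [hw0, hz0, ← dist_eq_norm]
      exact hwz.le
    have h2 : ‖φ s z - φ t z‖ ≤ M * |s - t| :=
      (hzs (t + 1)).norm_sub_le hM ⟨ht, by linarith⟩ hsI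
    have h3 : M * |s - t| ≤ ε / 2 := by
      rw [lt_div_iff₀ (by positivity)] at hst
      nlinarith [abs_nonneg (s - t)]
    rw [dist_eq_norm]
    linarith [norm_sub_le_norm_sub_add_norm_sub (φ s w) (φ s z) (φ t z)]
  · exact (((hφ z (hS hz)).2 (t + 1)).deriv t ⟨ht, by linarith⟩).mono_of_mem_nhdsWithin
      (inter_mem self_mem_nhdsWithin
      (mem_nhdsWithin_of_mem_nhds (Iic_mem_nhds (lt_add_one t))))
  · exact hF.solution_unique ⟨hγ.mono_right hS, hd⟩ ((hφ z (hS hz)).2 T)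
      (h0.trans (hφ z (hS hz)).1.symm)

/-- The holomorphic semiflow of an inward field, together with its uniform forward invariance. -/
theorem exists_holomorphicFlow (hF : IsInwardField F c B) :
    ∃ φ : ℝ → (Fin n → ℂ) → (Fin n → ℂ),
      HolomorphicFlowAssumption F φ ∧ ForwardInvarianceAssumption φ := by
  obtain ⟨φ, hφ⟩ := hF.exists_semiflow
  obtain ⟨κ, hκ0, hκ1, hκ⟩ := hF.exists_norm_solution_le
  have hball := openPolydisc_eq_ball (Fin n)
  have htorus : unitTorus (Fin n) ⊆ closedBall 0 1 :=
    (unitTorus_subset_closedPolydisc _).trans (closedPolydisc_eq_closedBall _).subset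
  have hS : openPolydisc (Fin n) ∪ unitTorus (Fin n) ⊆ closedBall 0 1 :=
    union_subset (hball.subset.trans ball_subset_closedBall) htorus
  refine ⟨φ, ⟨hball ▸ hF.differentiableOn, hF.continuousOn.mono hS,
    hF.generatesFlowOn hφ hS (hball ▸ subset_union_left), ?_, ?_⟩, ?_⟩
  · rw [hball]
    exact fun t ht => (hF.generatesFlowOn hφ ball_subset_closedBall subset_rfl).mapsTo t ht
  · rw [hball]
    exact fun t ht => hF.differentiableOn_semiflow hφ ht
  · intro t ht
    have h0 : 0 < t / (1 + t) := by positivity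
    have h1 : t / (1 + t) < 1 := by rw [div_lt_one (by positivity)]; linarith
    -- Half the available gap is kept, so that the inequality becomes strict.
    refine ⟨1 - κ * (t / (1 + t)) / 2, ⟨by nlinarith, by nlinarith⟩, fun z hz j => ?_⟩
    have hle := hκ t _ ((hφ z (htorus hz)).2 t) t ⟨ht.le, le_rfl⟩
    rw [mem_ball_zero_iff]
    nlinarith [norm_le_pi_norm (φ t z) j, mul_pos hκ0 h0]

end IsInwardField

/-! ### Reduction of the theorem to inward fields -/

theorem continuous_deleteCoord {n : ℕ} (j : Fin n) : Continuous (deleteCoord j) :=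
  continuous_pi fun i => continuous_apply (i : Fin n)

theorem differentiable_deleteCoord {n : ℕ} (j : Fin n) : Differentiable ℂ (deleteCoord j) :=
  differentiable_pi.2 fun i => differentiable_apply (i : Fin n)

theorem mapsTo_deleteCoord_closedPolydisc {n : ℕ} (j : Fin n) :
    MapsTo (deleteCoord j) (closedPolydisc (Fin n)) (closedPolydisc {i : Fin n // i ≠ j}) :=
  fun _ hz k => hz k

theorem mapsTo_deleteCoord_openPolydisc {n : ℕ} (j : Fin n) :
    MapsTo (deleteCoord j) (openPolydisc (Fin n)) (openPolydisc {i : Fin n // i ≠ j}) :=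
  fun _ hz k => hz k

theorem proposition3p4 (n : ℕ)
    (F : (Fin n → ℂ) → (Fin n → ℂ))
    (u : ∀ j : Fin n, ({i : Fin n // i ≠ j} → ℂ) → ℂ)
    (G : Fin n → (Fin n → ℂ) → ℂ)
    (hu_maps : ∀ j, MapsTo (u j) (closedPolydisc {i : Fin n // i ≠ j}) (Metric.closedBall 0 1))
    (hu_cont : ∀ j, ContinuousOn (u j) (closedPolydisc {i : Fin n // i ≠ j}))
    (hu_hol : ∀ j, DifferentiableOn ℂ (u j) (openPolydisc {i : Fin n // i ≠ j}))
    (hG_cont : ∀ j, ContinuousOn (G j) (closedPolydisc (Fin n)))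
    (hG_hol : ∀ j, DifferentiableOn ℂ (G j) (openPolydisc (Fin n)))
    (hF : ∀ z ∈ closedPolydisc (Fin n), ∀ j,
      F z j = (z j - u j (deleteCoord j z)) * G j z)
    (hneg : ∀ z ∈ closedPolydisc (Fin n), ∀ j,
      ((1 - (starRingEnd ℂ) (z j) * u j (deleteCoord j z)) * G j z).re < 0) :
    ∃ φ : ℝ → (Fin n → ℂ) → (Fin n → ℂ),
      HolomorphicFlowAssumption F φ ∧ ForwardInvarianceAssumption φ := by
  have hopen : openPolydisc (Fin n) ⊆ closedPolydisc (Fin n) := fun z hz k => (hz k).le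
  have hK : IsCompact (closedPolydisc (Fin n)) :=
    closedPolydisc_eq_closedBall (Fin n) ▸ isCompact_closedBall _ _
  have hu : ∀ j, ContinuousOn (fun z => u j (deleteCoord j z)) (closedPolydisc (Fin n)) := fun j =>
    (hu_cont j).comp (continuous_deleteCoord j).continuousOn (mapsTo_deleteCoord_closedPolydisc j)
  have hu' : ∀ j, DifferentiableOn ℂ (fun z => u j (deleteCoord j z)) (openPolydisc (Fin n)) :=
    fun j => (hu_hol j).comp (differentiable_deleteCoord j).differentiableOn
      (mapsTo_deleteCoord_openPolydisc j)
  have hcont : ContinuousOn F (closedPolydisc (Fin n)) := continuousOn_pi.2 fun j =>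
    (((continuous_apply j).continuousOn.sub (hu j)).mul (hG_cont j)).congr fun z hz => hF z hz j
  have hdiff : DifferentiableOn ℂ F (openPolydisc (Fin n)) := differentiableOn_pi.2 fun j =>
    (((differentiable_apply j).differentiableOn.sub (hu' j)).mul (hG_hol j)).congr
      fun z hz => hF z (hopen hz) j
  -- The real part attains a negative maximum on the compact polydisc. Stating this for all small
  -- `c` lets one `c` serve the finitely many `j`; likewise for large `B`.
  have hc : ∀ j, ∀ᶠ c : ℝ in 𝓝[>] 0, ∀ z ∈ closedPolydisc (Fin n),
      ((1 - (starRingEnd ℂ) (z j) * u j (deleteCoord j z)) * G j z).re ≤ -(2 * c) := fun j => by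
    have hcj : ContinuousOn (fun z : Fin n → ℂ =>
        ((1 - (starRingEnd ℂ) (z j) * u j (deleteCoord j z)) * G j z).re)
        (closedPolydisc (Fin n)) :=
      Complex.continuous_re.comp_continuousOn ((continuousOn_const.sub
        ((Complex.continuous_conj.comp (continuous_apply j)).continuousOn.mul (hu j))).mul
          (hG_cont j))
    obtain ⟨w, hw, hmax⟩ := hK.exists_isMaxOn ⟨0, fun k => by simp⟩ hcj
    have hlim : Tendsto (fun c : ℝ => -(2 * c)) (𝓝[>] 0) (𝓝 0) := by
      have : Continuous fun c : ℝ => -(2 * c) := by fun_prop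
      simpa using (this.tendsto 0).mono_left nhdsWithin_le_nhds
    filter_upwards [hlim.eventually (lt_mem_nhds (hneg w hw j))] with c hc z hz
    exact (hmax hz).trans hc.le
  have hB : ∀ j, ∀ᶠ B : ℝ in atTop, ∀ z ∈ closedPolydisc (Fin n), ‖G j z‖ ≤ B := fun j => by
    obtain ⟨b, hb⟩ := hK.exists_bound_of_continuousOn (hG_cont j)
    filter_upwards [eventually_ge_atTop b] with B hB z hz
    exact (hb z hz).trans hB
  obtain ⟨c, hc, hc0⟩ := ((eventually_all.2 hc).and self_mem_nhdsWithin).exists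
  obtain ⟨B, hB, hB0⟩ := ((eventually_all.2 hB).and (eventually_ge_atTop 0)).exists
  refine IsInwardField.exists_holomorphicFlow (c := c) (B := B)
    ⟨hc0, hB0, closedPolydisc_eq_closedBall (Fin n) ▸ hcont,
      openPolydisc_eq_ball (Fin n) ▸ hdiff, ?_⟩
  rw [← closedPolydisc_eq_closedBall]
  intro z hz j
  have hid : (starRingEnd ℂ) (z j) * F z j =
      (1 - (starRingEnd ℂ) (z j) * u j (deleteCoord j z)) * G j z
        - ((1 - ‖z j‖ ^ 2 : ℝ) : ℂ) * G j z := by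
    rw [hF z hz j]
    push_cast
    rw [← Complex.conj_mul']
    ring
  have hz2 : 0 ≤ 1 - ‖z j‖ ^ 2 := sub_nonneg.2 (pow_le_one₀ (norm_nonneg _) (hz j))
  have hre : -(G j z).re ≤ B :=
    (neg_le_abs _).trans ((Complex.abs_re_le_norm _).trans (hB j z hz))
  rw [hid, Complex.sub_re, Complex.re_ofReal_mul]
  nlinarith [hc j z hz, mul_le_mul_of_nonneg_right hre hz2]
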